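/- Let $(X,d)$ be a complete metric space with a Borel measure $\mu$ that is doubling: there is $C_d\ge 1$ with $0<\mu(B(x,2r))\le C_d\,\mu(B(x,r))<\infty$ for all $x\in X$, $r>0$. By a curve we mean a non-constant compact rectifiable curve in $X$, parametrized by arc length, $\gamma:[0,\ell(\gamma)]\to X$; for a Borel function $\rho:X\to[0,\infty]$ and $0\le s<t\le\ell(\gamma)$ put $\int_{\gamma|_{[s,t]}}\rho\,ds=\int_s^t\rho(\gamma(\tau))\,d\tau$ and $\int_\gamma\rho\,ds=\int_{\gamma|_{[0,\ell(\gamma)]}}\rho\,ds$, and for Borel $A\subset X$ put $\ell(\gamma\cap A)=\int_\gamma\chi_A\,ds$. Semmes pencil. $X$ supports a Semmes pencil of curves if there is $C>0$ such that for all $x\ne y$ in $X$ there are a family $\Gamma_{x,y}$ of curves from $x$ to $y$ with $\ell(\gamma)\le C\,d(x,y)$ for each $\gamma\in\Gamma_{x,y}$, and a probability measure $\sigma_{x,y}$ on $\Gamma_{x,y}$, such that for each Borel set $A\subset X$ the map $\gamma\mapsto\ell(\gamma\cap A)$ is $\sigma_{x,y}$-measurable and $$\int_{\Gamma_{x,y}}\ell(\gamma\cap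 A)\,d\sigma_{x,y}(\gamma)\le C\int_{A\cap (B(x,Cd(x,y))\cup B(y,Cd(x,y)))}\left(\frac{d(x,z)}{\mu(B(x,d(x,z)))}+\frac{d(y,z)}{\mu(B(y,d(y,z)))}\right)d\mu(z),$$ where $0/0=0$. $BV_{AM}$. The AM-modulus of a family $\Gamma$ of curves is $\mathrm{AM}(\Gamma)=\inf\liminf_{i\to\infty}\int_X\rho_i\,d\mu$, the infimum being over all sequences of Borel functions $\rho_i:X\to[0,\infty]$ with $\liminf_{i}\int_\gamma\rho_i\,ds\ge 1$ for every $\gamma\in\Gamma$. Let $V$ be a Banach space. A sequence $(\rho_i)$ of Borel functions $X\to[0,\infty]$ is an AM-upper bound of $u:X\to V$ if there is a family $\Gamma$ with $\mathrm{AM}(\Gamma)=0$ such that for every curve $\gamma\notin\Gamma$ there is a Lebesgue null set $N_\gamma$ with $$\|u(\gamma(s))-u(\gamma(t))\|\le\liminf_{i\to\infty}\int_{\gamma|_{[s,t]}}\rho_i\,ds\qquad\text{for all } s<t \text{ in } [0,\ell(\gamma)]\setminus N_\gamma .$$ Finally $u\in BV_{AM}(X:V)$ if $u\in L^1(X:V)$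 (Bochner) and $u$ has an AM-upper bound with $\liminf_{i}\int_X\rho_i\,d\mu<\infty$. Theorem. Suppose that $X$ supports a Semmes pencil of curves and that $\liminf_{r\to0^+}\mu(B(x,r))/r=0$ for $\mu$-a.e. $x\in X$. Then $X$ supports an AM–Poincaré inequality for every Banach space: there are constants $C>0$ and $\lambda\ge1$ such that for every Banach space $V$, every $u\in BV_{AM}(X:V)$, every AM-upper bound $(\rho_i)$ of $u$ and every ball $B=B(x,r)$, with $\lambda B=B(x,\lambda r)$ and $u_B$ the average $\frac1{\mu(B)}\int_B u\,d\mu$, $$\frac1{\mu(B)}\int_B\|u-u_B\|\,d\mu\le C\,r\,\liminf_{i\to\infty}\frac1{\mu(\lambda B)}\int_{\lambda B}\rho_i\,d\mu .$$ -/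

import Mathlib

open MeasureTheory Set Filter Topology
open scoped ENNReal

universe u v

namespace AMBV

/-- A non-constant compact rectifiable curve in `X`, parametrized by arc length on `[0, length]`.
Only the values of `toFun` on `[0, length]` are relevant. -/
structure RectCurve (X : Type*) [MetricSpace X] where
  /-- the length of the curve -/
  length : ℝ
  /-- the arc-length parametrization -/
  toFun : ℝ → X
  length_pos : 0 < length
  unitSpeed : HasUnitSpeedOn toFun (Icc 0 length)

variable {X : Type*} [MetricSpace X] [MeasurableSpace X]

/-- The line integral `∫_{γ|[s,t]} ρ ds` over the subcurve `γ|[s,t]`. -/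
noncomputable def RectCurve.subIntegral (γ : RectCurve X) (ρ : X → ℝ≥0∞) (s t : ℝ) : ℝ≥0∞ :=
  ∫⁻ τ in Icc s t, ρ (γ.toFun τ)

/-- The line integral `∫_γ ρ ds`. -/
noncomputable def RectCurve.lineIntegral (γ : RectCurve X) (ρ : X → ℝ≥0∞) : ℝ≥0∞ :=
  γ.subIntegral ρ 0 γ.length

/-- The length `ℓ(γ ∩ A) = ∫_γ χ_A ds` of the part of `γ` in `A`. -/
noncomputable def RectCurve.lengthIn (γ : RectCurve X) (A : Set X) : ℝ≥0∞ :=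
  γ.lineIntegral (A.indicator 1)

/-- The AM-modulus of a family of curves. -/
noncomputable def AM (μ : Measure X) (Γ : Set (RectCurve X)) : ℝ≥0∞ :=
  ⨅ (ρ : ℕ → X → ℝ≥0∞) (_ : ∀ i, Measurable (ρ i))
    (_ : ∀ γ ∈ Γ, 1 ≤ liminf (fun i => γ.lineIntegral (ρ i)) atTop),
    liminf (fun i => ∫⁻ x, ρ i x ∂μ) atTop

/-- `(ρ_i)` is an AM-bounding sequence (AM-upper bound) for `u`. -/
def IsAMBounding {V : Type*} [NormedAddCommGroup V] (μ : Measure X) (u : X → V)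
    (ρ : ℕ → X → ℝ≥0∞) : Prop :=
  (∀ i, Measurable (ρ i)) ∧
  ∃ Γ : Set (RectCurve X), AM μ Γ = 0 ∧ ∀ γ : RectCurve X, γ ∉ Γ →
    ∃ N : Set ℝ, volume N = 0 ∧
      ∀ s ∈ Icc 0 γ.length \ N, ∀ t ∈ Icc 0 γ.length \ N, s < t →
        ‖u (γ.toFun s) - u (γ.toFun t)‖ₑ ≤ liminf (fun i => γ.subIntegral (ρ i) s t) atTop

/-- `u` belongs to the class `BV_AM(X : V)`. -/
def MemBVAM {V : Type*} [NormedAddCommGroup V] (μ : Measure X) (u : X → V) : Prop :=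
  Integrable u μ ∧
  ∃ ρ : ℕ → X → ℝ≥0∞, IsAMBounding μ u ρ ∧ liminf (fun i => ∫⁻ x, ρ i x ∂μ) atTop < ∞

/-- The measure `μ` is doubling; balls have positive and finite measure. -/
def IsDoubling (μ : Measure X) : Prop :=
  ∃ Cd : ℝ, 1 ≤ Cd ∧ ∀ (x : X) (r : ℝ), 0 < r →
    0 < μ (Metric.ball x (2 * r)) ∧
    μ (Metric.ball x (2 * r)) ≤ ENNReal.ofReal Cd * μ (Metric.ball x r) ∧
    μ (Metric.ball x r) < ∞

/-- The kernel `R_{x,y}(z) = d(x,z)/μ(B(x,d(x,z))) + d(y,z)/μ(B(y,d(y,z)))`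
(a summand is `0` where its numerator and denominator both vanish). -/
noncomputable def semmesKernel (μ : Measure X) (x y z : X) : ℝ≥0∞ :=
  ENNReal.ofReal (dist x z) / μ (Metric.ball x (dist x z)) +
    ENNReal.ofReal (dist y z) / μ (Metric.ball y (dist y z))

/-- `(X, d, μ)` supports a Semmes pencil of curves. -/
def HasSemmesPencil (μ : Measure X) : Prop :=
  ∃ C : ℝ, 0 < C ∧ ∀ x y : X, x ≠ y →
    ∃ (Γ : Set (RectCurve X)) (_ : MeasurableSpace Γ) (σ : Measure Γ),
      IsProbabilityMeasure σ ∧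
      (∀ γ ∈ Γ, γ.toFun 0 = x ∧ γ.toFun γ.length = y ∧ γ.length ≤ C * dist x y) ∧
      ∀ A : Set X, MeasurableSet A →
        AEMeasurable (fun γ : Γ => γ.1.lengthIn A) σ ∧
        ∫⁻ γ : Γ, γ.1.lengthIn A ∂σ ≤
          ENNReal.ofReal C *
            ∫⁻ z in A ∩ (Metric.ball x (C * dist x y) ∪ Metric.ball y (C * dist x y)),
              semmesKernel μ x y z ∂μ

/-- The AM–Poincaré inequality with constants `C` and `lam` for maps into `V`. -/
def AMPoincareWith (μ : Measure X) (V : Type*) [NormedAddCommGroup V] [NormedSpace ℝ V]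
    (C lam : ℝ) : Prop :=
  ∀ u : X → V, MemBVAM μ u → ∀ ρ : ℕ → X → ℝ≥0∞, IsAMBounding μ u ρ →
    ∀ (x : X) (r : ℝ), 0 < r →
      ⨍⁻ y in Metric.ball x r, ‖u y - ⨍ z in Metric.ball x r, u z ∂μ‖ₑ ∂μ ≤
        ENNReal.ofReal (C * r) *
          liminf (fun i => ⨍⁻ y in Metric.ball x (lam * r), ρ i y ∂μ) atTop

end AMBV

namespace AMBV

open Metric
open scoped NNReal

/-! ### Consequences of doubling -/

section Doubling

variable {X : Type*} [MetricSpace X] [MeasurableSpace X] {μ : Measure X}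

/-! For a.e. pair `(x, y)` one shows `‖u x - u y‖ ≤ 2 ∫ liminf ∫_γ ρ_i dσ_{x,y}`. Fatou and the
pencil bound the right side by a Riesz-type potential of `ρ_i`. Integrating over `B × B`, with
Fatou, Tonelli and the doubling estimate `∫_B d(x,z)/μ(B(x,d(x,z))) dμ(x) ≲ r`, gives the
inequality.

There are two obstacles. First, the upper bound on a curve ignores a null set of parameters, so it
says nothing about the endpoints. Let `x` be a Lebesgue point of `u`; the set `A` where `u` is at
least `δ` away from `u x` has density zero at `x`. The kernel integrated over `A ∩ B(x,r)` is then
`o(r)` along suitable `r → 0`: the part singular at `x` is small by density, and the part centred at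
`y` is bounded near `x`, so it is small because `liminf μ(B(x,r))/r = 0`. By Chebyshev most curves
spend less than `r/2` of length in `A ∩ B(x,r)`, hence leave `A` at a usable parameter near `x`. The
same holds at `y`, so at least half of the pencil connects good points
(`enorm_sub_le_two_mul_lintegral_liminf`).

Second, the exceptional family must be `σ_{x,y}`-null for a.e. pair. Its test sequences have
arbitrarily small energy, and the same potential estimate makes the infimum of their potentials
vanish a.e. -/

theorem IsDoubling.measure_ball_pos (hμ : IsDoubling μ) (x : X) {r : ℝ} (hr : 0 < r) :
    0 < μ (ball x r) := by
  obtain ⟨C, -, h⟩ := hμ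
  have := (h x (r / 2) (half_pos hr)).1
  rwa [mul_div_cancel₀ r two_ne_zero] at this

theorem IsDoubling.measure_ball_lt_top (hμ : IsDoubling μ) (x : X) (r : ℝ) :
    μ (ball x r) < ∞ := by
  obtain ⟨C, -, h⟩ := hμ
  rcases lt_or_ge 0 r with hr | hr
  · exact (h x r hr).2.2
  · simp [ball_eq_empty.2 hr]

theorem IsDoubling.exists_measure_ball_pow_le (hμ : IsDoubling μ) :
    ∃ K : ℝ≥0, ∀ (n : ℕ) (x : X) (r : ℝ), 0 < r →
      μ (ball x (2 ^ n * r)) ≤ (K : ℝ≥0∞) ^ n * μ (ball x r) := by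
  obtain ⟨C, -, h⟩ := hμ
  refine ⟨C.toNNReal, fun n => ?_⟩
  induction n with
  | zero => intro x r _; simp
  | succ n ih =>
    intro x r hr
    calc μ (ball x (2 ^ (n + 1) * r)) = μ (ball x (2 * (2 ^ n * r))) := by ring_nf
      _ ≤ ENNReal.ofReal C * μ (ball x (2 ^ n * r)) := (h x _ (by positivity)).2.1
      _ ≤ ENNReal.ofReal C * ((C.toNNReal : ℝ≥0∞) ^ n * μ (ball x r)) := by
        gcongr; exact ih x r hr
      _ = (C.toNNReal : ℝ≥0∞) ^ (n + 1) * μ (ball x r) := by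
        rw [pow_succ', mul_assoc]; rfl

theorem IsDoubling.sigmaFinite (hμ : IsDoubling μ) : SigmaFinite μ := by
  rcases isEmpty_or_nonempty X with h | ⟨⟨x₀⟩⟩
  · rw [Measure.eq_zero_of_isEmpty μ]; infer_instance
  · exact ⟨⟨{ set := fun n : ℕ => ball x₀ n
              set_mem := fun _ => trivial
              finite := fun n => hμ.measure_ball_lt_top x₀ n
              spanning := iUnion_ball_nat x₀ }⟩⟩

theorem IsDoubling.isLocallyFiniteMeasure (hμ : IsDoubling μ) : IsLocallyFiniteMeasure μ :=
  ⟨fun x => ⟨ball x 1, ball_mem_nhds x one_pos, hμ.measure_ball_lt_top x 1⟩⟩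

theorem IsDoubling.isUnifLocDoublingMeasure (hμ : IsDoubling μ) :
    IsUnifLocDoublingMeasure μ := by
  obtain ⟨K, hK⟩ := hμ.exists_measure_ball_pow_le
  refine ⟨⟨K ^ 2, ?_⟩⟩
  filter_upwards [self_mem_nhdsWithin] with ε hε x
  have hε : 0 < ε := hε
  calc μ (closedBall x (2 * ε)) ≤ μ (ball x (2 ^ 2 * ε)) :=
        measure_mono (closedBall_subset_ball (by linarith))
    _ ≤ (K : ℝ≥0∞) ^ 2 * μ (ball x ε) := hK 2 x ε hε
    _ ≤ ((K ^ 2 : ℝ≥0) : ℝ≥0∞) * μ (closedBall x ε) := by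
      push_cast
      gcongr
      exact ball_subset_closedBall

/-- A disjoint family of balls of positive measure is countable when `μ` is σ-finite, and by Vitali
the enlarged balls cover. This gives joint measurability of the distance on products, needed for
Tonelli. -/
theorem IsDoubling.secondCountableTopology [BorelSpace X] (hμ : IsDoubling μ) :
    SecondCountableTopology X := by
  have := hμ.sigmaFinite
  refine secondCountable_of_almost_dense_set fun ε hε => ?_
  obtain ⟨s, -, hdisj, hcov⟩ := Vitali.exists_disjoint_subfamily_covering_enlargement_closedBall
    (univ : Set X) (fun x => x) (fun _ => ε / 5) (ε / 5) (fun _ _ => le_rfl) 5 (by norm_num)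
  refine ⟨s, ?_, fun x => ?_⟩
  · have hc := Measure.countable_meas_pos_of_disjoint_iUnion (μ := μ)
      (As := fun x : s => closedBall (x : X) (ε / 5)) (fun _ => measurableSet_closedBall)
      (fun a b hab => hdisj a.2 b.2 (fun h => hab (Subtype.ext h)))
    have : {i : s | 0 < μ (closedBall (i : X) (ε / 5))} = univ :=
      eq_univ_of_forall fun i => (hμ.measure_ball_pos (i : X) (by positivity)).trans_le
        (measure_mono ball_subset_closedBall)
    rw [this] at hc
    exact countable_coe_iff.1 (countable_univ_iff.1 hc)
  · obtain ⟨y, hy, hsub⟩ := hcov x (mem_univ x)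
    refine ⟨y, hy, ?_⟩
    have := hsub (mem_closedBall_self (by positivity))
    rwa [mem_closedBall, mul_div_cancel₀ ε (by norm_num)] at this

end Doubling

/-! ### Dyadic annuli -/

section Annuli

variable {X : Type*} [MetricSpace X] [MeasurableSpace X]

/-- The annulus of outer radius `D / 2 ^ n` contributes at most `M * D / 2 ^ n`, a geometric series.
The centre lies in no annulus and may be an atom, hence `k p = 0`. -/
theorem setLIntegral_ball_le_of_annuli [MeasurableSingletonClass X] [OpensMeasurableSpace X]
    {ν : Measure X} {p : X} {D : ℝ} {k : X → ℝ≥0∞}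
    (hp : k p = 0) {M : ℝ≥0∞}
    (h : ∀ s, 0 < s → s ≤ D → ∃ K, (∀ z, s / 2 < dist z p → dist z p ≤ s → k z ≤ K) ∧
      K * ν (closedBall p s) ≤ M * ENNReal.ofReal s) :
    ∫⁻ z in ball p D, k z ∂ν ≤ M * ENNReal.ofReal (2 * D) := by
  rcases le_or_gt D 0 with hD | hD
  · simp [ball_eq_empty.2 hD]
  let A : ℕ → Set X := fun n => {z | D / 2 ^ n / 2 < dist z p ∧ dist z p ≤ D / 2 ^ n}
  have hA : ∀ n, MeasurableSet (A n) := fun n =>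
    (measurableSet_lt measurable_const (continuous_id.dist continuous_const).measurable).inter
      (measurableSet_le (continuous_id.dist continuous_const).measurable measurable_const)
  have hcov : ball p D ⊆ {p} ∪ ⋃ n, A n := by
    intro z hz
    rcases eq_or_ne z p with rfl | hzp
    · exact Or.inl rfl
    right
    have hd : 0 < dist z p := dist_pos.2 hzp
    have hz : dist z p < D := hz
    obtain ⟨n, hn, hn'⟩ := exists_nat_pow_near (x := D / dist z p) (y := 2)
      ((one_le_div hd).2 hz.le) one_lt_two
    refine mem_iUnion.2 ⟨n, ?_, ?_⟩
    · rw [div_div, ← pow_succ, div_lt_iff₀ (by positivity)]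
      rwa [div_lt_iff₀ hd, mul_comm] at hn'
    · rw [le_div_iff₀ (by positivity)]
      rwa [le_div_iff₀ hd, mul_comm] at hn
  have hAn : ∀ n, ∫⁻ z in A n, k z ∂ν ≤ M * ENNReal.ofReal (D / 2 ^ n) := by
    intro n
    obtain ⟨K, hK, hKM⟩ := h (D / 2 ^ n) (by positivity)
      (div_le_self hD.le (one_le_pow₀ one_le_two))
    calc ∫⁻ z in A n, k z ∂ν ≤ ∫⁻ _ in A n, K ∂ν :=
          setLIntegral_mono' (hA n) fun z hz => hK z hz.1 hz.2
      _ = K * ν (A n) := setLIntegral_const _ _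
      _ ≤ K * ν (closedBall p (D / 2 ^ n)) := by gcongr; exact fun z hz => hz.2
      _ ≤ _ := hKM
  have hsum : ∑' n : ℕ, ENNReal.ofReal (D / 2 ^ n) = ENNReal.ofReal (2 * D) := by
    have h2 : ∀ n : ℕ, D / 2 ^ n = 2 * D / 2 / 2 ^ n := fun n => by
      rw [mul_div_cancel_left₀ D two_ne_zero]
    simp_rw [h2]
    rw [← ENNReal.ofReal_tsum_of_nonneg (fun n => by positivity) (summable_geometric_two' _),
      tsum_geometric_two']
  calc ∫⁻ z in ball p D, k z ∂ν ≤ ∫⁻ z in {p} ∪ ⋃ n, A n, k z ∂ν := lintegral_mono_set hcov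
    _ ≤ ∫⁻ z in {p}, k z ∂ν + ∫⁻ z in ⋃ n, A n, k z ∂ν := lintegral_union_le _ _ _
    _ ≤ 0 + ∑' n, M * ENNReal.ofReal (D / 2 ^ n) := by
      gcongr
      · rw [lintegral_singleton, hp, zero_mul]
      · exact (lintegral_iUnion_le _ _).trans (ENNReal.tsum_le_tsum hAn)
    _ = M * ENNReal.ofReal (2 * D) := by rw [zero_add, ENNReal.tsum_mul_left, hsum]

end Annuli

/-! ### Riesz kernel estimates and Lebesgue points -/

section Kernel

variable {X : Type*} [MetricSpace X] [MeasurableSpace X]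

/-- The Riesz kernel `d(x,z)/μ(B(x,d(x,z)))`. -/
noncomputable def rieszKernel (μ : Measure X) (x z : X) : ℝ≥0∞ :=
  ENNReal.ofReal (dist x z) / μ (ball x (dist x z))

theorem semmesKernel_eq (μ : Measure X) (x y z : X) :
    semmesKernel μ x y z = rieszKernel μ x z + rieszKernel μ y z := rfl

theorem semmesKernel_comm (μ : Measure X) (x y z : X) :
    semmesKernel μ x y z = semmesKernel μ y x z := add_comm _ _

theorem rieszKernel_self (μ : Measure X) (x : X) : rieszKernel μ x x = 0 := by
  simp [rieszKernel]

theorem measurable_rieszKernel [BorelSpace X] [SecondCountableTopology X]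
    (μ : Measure X) [SFinite μ] : Measurable fun p : X × X => rieszKernel μ p.1 p.2 := by
  have hS : MeasurableSet {q : (X × X) × X | dist q.2 q.1.1 < dist q.1.1 q.1.2} :=
    measurableSet_lt (by fun_prop) (by fun_prop)
  have := measurable_measure_prodMk_left (ν := μ) hS
  refine Measurable.div ?_ this
  exact (measurable_fst.dist measurable_snd).ennreal_ofReal

variable {μ : Measure X} {K : ℝ≥0}

/-- Here the centre of the kernel's ball varies. If `s/2 < d(x,z) ≤ s`, the closed ball of radius
`s` about `z` lies in `B(x, 4 d(x,z))`, so two doublings replace the moving ball by a fixed one. -/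
theorem lintegral_rieszKernel_left_le [BorelSpace X]
    (hpos : ∀ (x : X) (r : ℝ), 0 < r → 0 < μ (ball x r))
    (hfin : ∀ (x : X) (r : ℝ), μ (ball x r) < ∞)
    (hK : ∀ (n : ℕ) (x : X) (r : ℝ), 0 < r →
      μ (ball x (2 ^ n * r)) ≤ (K : ℝ≥0∞) ^ n * μ (ball x r))
    (z : X) (D : ℝ) :
    ∫⁻ x in ball z D, rieszKernel μ x z ∂μ ≤ (K : ℝ≥0∞) ^ 2 * ENNReal.ofReal (2 * D) := by
  refine setLIntegral_ball_le_of_annuli (k := fun x => rieszKernel μ x z) (rieszKernel_self μ z)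
    fun s hs _ => ?_
  have hm0 : μ (closedBall z s) ≠ 0 :=
    ((hpos z s hs).trans_le (measure_mono ball_subset_closedBall)).ne'
  have hmt : μ (closedBall z s) ≠ ∞ :=
    ((measure_mono (closedBall_subset_ball (lt_add_one s))).trans_lt (hfin z _)).ne
  refine ⟨K ^ 2 * ENNReal.ofReal s / μ (closedBall z s), fun x h1 h2 => ?_, ?_⟩
  · have hle : μ (closedBall z s) ≤ (K : ℝ≥0∞) ^ 2 * μ (ball x (dist x z)) := by
      refine (measure_mono fun w hw => ?_).trans (hK 2 x (dist x z) (by linarith))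
      have hw : dist w z ≤ s := hw
      have := dist_triangle w z x
      rw [dist_comm z x] at this
      rw [mem_ball]
      linarith
    rw [rieszKernel, ENNReal.le_div_iff_mul_le (Or.inl hm0) (Or.inl hmt)]
    have hb0 := (hpos x (dist x z) (by linarith)).ne'
    have hbt := (hfin x (dist x z)).ne
    calc ENNReal.ofReal (dist x z) / μ (ball x (dist x z)) * μ (closedBall z s)
        ≤ ENNReal.ofReal s / μ (ball x (dist x z)) * (K ^ 2 * μ (ball x (dist x z))) := by gcongr
      _ = K ^ 2 * ENNReal.ofReal s * (μ (ball x (dist x z)) / μ (ball x (dist x z))) := by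
        simp only [div_eq_mul_inv]; ring
      _ = K ^ 2 * ENNReal.ofReal s := by rw [ENNReal.div_self hb0 hbt, mul_one]
  · rw [ENNReal.div_mul_cancel hm0 hmt]

theorem lintegral_rieszKernel_right_le [BorelSpace X]
    (hpos : ∀ (x : X) (r : ℝ), 0 < r → 0 < μ (ball x r))
    (hfin : ∀ (x : X) (r : ℝ), μ (ball x r) < ∞)
    (hK : ∀ (n : ℕ) (x : X) (r : ℝ), 0 < r →
      μ (ball x (2 ^ n * r)) ≤ (K : ℝ≥0∞) ^ n * μ (ball x r))
    (x : X) {r : ℝ} {A : Set X} {η : ℝ≥0∞}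
    (hA : ∀ s, 0 < s → s ≤ r → μ (A ∩ closedBall x s) ≤ η * μ (closedBall x s)) :
    ∫⁻ z in A ∩ ball x r, rieszKernel μ x z ∂μ ≤ η * (K : ℝ≥0∞) ^ 2 * ENNReal.ofReal (2 * r) := by
  rw [inter_comm, ← Measure.restrict_restrict measurableSet_ball]
  refine setLIntegral_ball_le_of_annuli (rieszKernel_self μ x) fun s hs hsr => ?_
  have hb0 := (hpos x (s / 2) (half_pos hs)).ne'
  have hbt := (hfin x (s / 2)).ne
  refine ⟨ENNReal.ofReal s / μ (ball x (s / 2)), fun z h1 h2 => ?_, ?_⟩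
  · rw [rieszKernel, dist_comm x z]
    gcongr
  · have hle : μ (closedBall x s) ≤ (K : ℝ≥0∞) ^ 2 * μ (ball x (s / 2)) :=
      (measure_mono (closedBall_subset_ball (by linarith))).trans (hK 2 x (s / 2) (half_pos hs))
    rw [Measure.restrict_apply measurableSet_closedBall, inter_comm]
    calc ENNReal.ofReal s / μ (ball x (s / 2)) * μ (A ∩ closedBall x s)
        ≤ ENNReal.ofReal s / μ (ball x (s / 2)) * (η * (K ^ 2 * μ (ball x (s / 2)))) := by
          gcongr; exact (hA s hs hsr).trans (by gcongr)
      _ = η * K ^ 2 * ENNReal.ofReal s * (μ (ball x (s / 2)) / μ (ball x (s / 2))) := by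
        simp only [div_eq_mul_inv]; ring
      _ = η * K ^ 2 * ENNReal.ofReal s := by rw [ENNReal.div_self hb0 hbt, mul_one]

/-- The only place where the small lower density of `μ` enters: it controls the summand centred at
`y`, while zero density of `A` controls the summand centred at `x`. -/
theorem exists_radius_lintegral_semmesKernel_le [BorelSpace X] (hμ : IsDoubling μ)
    {x y : X} (hxy : x ≠ y) {A : Set X}
    (hA : Tendsto (fun s => μ (A ∩ closedBall x s) / μ (closedBall x s)) (𝓝[>] 0) (𝓝 0))
    (hlim : liminf (fun r : ℝ => μ (ball x r) / ENNReal.ofReal r) (𝓝[>] 0) = 0)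
    {ε : ℝ≥0∞} (hε : ε ≠ 0) {R : ℝ} (hR : 0 < R) :
    ∃ r, 0 < r ∧ r ≤ R ∧
      ∫⁻ z in A ∩ ball x r, semmesKernel μ x y z ∂μ ≤ ε * ENNReal.ofReal r := by
  have := hμ.sigmaFinite
  have := hμ.secondCountableTopology
  have hpos : ∀ (x : X) (r : ℝ), 0 < r → 0 < μ (ball x r) := fun x r => hμ.measure_ball_pos x
  have hfin := hμ.measure_ball_lt_top
  obtain ⟨K, hK⟩ := hμ.exists_measure_ball_pow_le
  have hε2 : ε / 2 ≠ 0 := (ENNReal.half_pos hε).ne'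
  obtain ⟨η, hη0, hη⟩ := ENNReal.exists_nnreal_pos_mul_lt (a := (K : ℝ≥0∞) ^ 2 * 2)
    (by finiteness) hε2
  set d := dist x y with hd
  have hd0 : 0 < d := dist_pos.2 hxy
  have hby := (hpos y (d / 2) (half_pos hd0)).ne'
  -- Upper bound for the kernel centred at `y` on `B(x,r)` with `r < d / 2`, where `d/2 ≤ d(y,z) ≤
  -- 2d`.
  set Ky : ℝ≥0∞ := ENNReal.ofReal (2 * d) / μ (ball y (d / 2)) with hKy
  obtain ⟨η', hη0', hη'⟩ := ENNReal.exists_nnreal_pos_mul_lt (a := Ky)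
    (ENNReal.div_ne_top ENNReal.ofReal_ne_top hby) hε2
  have h1 : ∀ᶠ s in 𝓝[>] (0 : ℝ), μ (A ∩ closedBall x s) / μ (closedBall x s) < η :=
    hA.eventually (gt_mem_nhds (by exact_mod_cast hη0))
  obtain ⟨r₀, hr₀, hr₀'⟩ := mem_nhdsGT_iff_exists_Ioo_subset.1 h1
  have hr₀ : 0 < r₀ := hr₀
  -- A liminf gives good radii only frequently; the density condition holds at all small radii, so
  -- the two can be combined.
  have h2 : ∃ᶠ r in 𝓝[>] (0 : ℝ), μ (ball x r) / ENNReal.ofReal r < η' :=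
    frequently_lt_of_liminf_lt (by isBoundedDefault) (by rw [hlim]; exact_mod_cast hη0')
  have h3 : ∀ᶠ r in 𝓝[>] (0 : ℝ), r ∈ Ioo 0 (min r₀ (min R (d / 2))) :=
    Ioo_mem_nhdsGT (by positivity)
  obtain ⟨r, hr, hr0, hr'⟩ := (h2.and_eventually h3).exists
  simp only [lt_min_iff] at hr'
  obtain ⟨hrr₀, hrR, hrd⟩ := hr'
  refine ⟨r, hr0, hrR.le, ?_⟩
  have hm : Measurable fun z => rieszKernel μ x z :=
    (measurable_rieszKernel μ).comp measurable_prodMk_left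
  have hx : ∫⁻ z in A ∩ ball x r, rieszKernel μ x z ∂μ ≤ ε / 2 * ENNReal.ofReal r := by
    refine (lintegral_rieszKernel_right_le hpos hfin hK x (η := η) fun s hs hsr => ?_).trans ?_
    · have hlt := hr₀' ⟨hs, hsr.trans_lt hrr₀⟩
      have hm0 : μ (closedBall x s) ≠ 0 :=
        ((hpos x s hs).trans_le (measure_mono ball_subset_closedBall)).ne'
      have hmt : μ (closedBall x s) ≠ ∞ :=
        ((measure_mono (closedBall_subset_ball (lt_add_one s))).trans_lt (hfin x _)).ne
      exact (ENNReal.div_le_iff hm0 hmt).1 (le_of_lt hlt)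
    · rw [ENNReal.ofReal_mul zero_le_two, ← mul_assoc]
      gcongr
      rw [mul_assoc]
      simpa using hη.le
  have hy : ∫⁻ z in A ∩ ball x r, rieszKernel μ y z ∂μ ≤ ε / 2 * ENNReal.ofReal r := by
    calc ∫⁻ z in A ∩ ball x r, rieszKernel μ y z ∂μ
        ≤ ∫⁻ z in ball x r, rieszKernel μ y z ∂μ := lintegral_mono_set inter_subset_right
      _ ≤ ∫⁻ _ in ball x r, Ky ∂μ := by
        refine setLIntegral_mono' measurableSet_ball fun z hz => ?_
        have hz : dist z x < r := hz
        have t1 := dist_triangle x z y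
        have t2 := dist_triangle y x z
        rw [dist_comm x z, dist_comm z y] at t1
        rw [dist_comm y x, dist_comm x z] at t2
        rw [rieszKernel, hKy]
        gcongr <;> linarith
      _ = Ky * μ (ball x r) := setLIntegral_const _ _
      _ ≤ Ky * (η' * ENNReal.ofReal r) := by
        gcongr
        exact (ENNReal.div_le_iff (ENNReal.ofReal_pos.2 hr0).ne' ENNReal.ofReal_ne_top).1 hr.le
      _ ≤ ε / 2 * ENNReal.ofReal r := by
        rw [← mul_assoc, mul_comm Ky]
        gcongr
  simp_rw [semmesKernel_eq]
  rw [lintegral_add_left hm]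
  calc _ ≤ ε / 2 * ENNReal.ofReal r + ε / 2 * ENNReal.ofReal r := add_le_add hx hy
    _ = ε * ENNReal.ofReal r := by rw [← add_mul, ENNReal.add_halves]

/-- Lebesgue differentiation and Chebyshev; one Lebesgue point serves all `δ`. Since `u` is only
a.e. strongly measurable, the bad set is replaced by its measurable hull, which has the same measure
inside each ball. -/
theorem ae_tendsto_measure_enorm_sub_ge_div [BorelSpace X] (hμ : IsDoubling μ)
    {V : Type*} [NormedAddCommGroup V] {u : X → V} (hu : Integrable u μ) :
    ∀ᵐ x ∂μ, ∀ δ : ℝ≥0, δ ≠ 0 →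
      Tendsto (fun s => μ (toMeasurable μ {z | (δ : ℝ≥0∞) ≤ ‖u z - u x‖ₑ} ∩ closedBall x s) /
        μ (closedBall x s)) (𝓝[>] 0) (𝓝 0) := by
  have := hμ.sigmaFinite
  have := hμ.secondCountableTopology
  have := hμ.isLocallyFiniteMeasure
  have := hμ.isUnifLocDoublingMeasure
  filter_upwards [(IsUnifLocDoublingMeasure.vitaliFamily μ 1).ae_tendsto_lintegral_enorm_sub_div
    hu.locallyIntegrable] with x hx δ hδ
  have hδ0 : (δ : ℝ≥0∞) ≠ 0 := by exact_mod_cast hδ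
  have hx' := hx.comp (IsUnifLocDoublingMeasure.tendsto_closedBall_filterAt μ (K := 1)
    (l := 𝓝[>] (0 : ℝ)) (fun _ => x) (fun s => s) tendsto_id
    (by filter_upwards [self_mem_nhdsWithin] with s hs
        exact mem_closedBall_self (by rw [one_mul]; exact (mem_Ioi.1 hs).le)))
  have hx'' := ENNReal.Tendsto.const_mul (a := (δ : ℝ≥0∞)⁻¹) hx'
    (Or.inr (ENNReal.inv_ne_top.2 hδ0))
  rw [mul_zero] at hx''
  refine tendsto_of_tendsto_of_tendsto_of_le_of_le tendsto_const_nhds hx''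
    (fun _ => zero_le) fun s => ?_
  have hmk := mul_meas_ge_le_lintegral₀ (μ := μ.restrict (closedBall x s))
    (f := fun z => ‖u z - u x‖ₑ)
    ((hu.aestronglyMeasurable.sub aestronglyMeasurable_const).enorm.restrict) δ
  rw [Measure.measure_toMeasurable_inter_of_sFinite measurableSet_closedBall,
    ← Measure.restrict_apply' measurableSet_closedBall]
  simp only [Function.comp_apply]
  rw [← mul_div_assoc]
  gcongr
  rw [mul_comm, ← div_eq_mul_inv, ENNReal.le_div_iff_mul_le (Or.inl hδ0) (Or.inl ENNReal.coe_ne_top),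
    mul_comm]
  exact hmk

end Kernel

/-! ### Integrating the potential over pairs -/

section Fubini

variable {X : Type*} [MetricSpace X] [MeasurableSpace X] {μ : Measure X}

theorem measurable_semmesKernel_mul [BorelSpace X] [SecondCountableTopology X] [SFinite μ]
    {f : X → ℝ≥0∞} (hf : Measurable f) :
    Measurable fun q : (X × X) × X => semmesKernel μ q.1.1 q.1.2 q.2 * f q.2 := by
  have h := measurable_rieszKernel μ
  simp_rw [semmesKernel_eq]
  exact ((h.comp (measurable_fst.fst.prodMk measurable_snd)).add
    (h.comp (measurable_fst.snd.prodMk measurable_snd))).mul (hf.comp measurable_snd)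

theorem lintegral_prod_lintegral_semmesKernel_le [BorelSpace X] (hμ : IsDoubling μ) (lam : ℝ) :
    ∃ M : ℝ≥0, ∀ (x₀ : X) (r : ℝ), 0 < r → ∀ f : X → ℝ≥0∞, Measurable f →
      ∫⁻ p, ∫⁻ z in ball x₀ (lam * r), semmesKernel μ p.1 p.2 z * f z ∂μ
          ∂((μ.restrict (ball x₀ r)).prod (μ.restrict (ball x₀ r))) ≤
        M * ENNReal.ofReal r * μ (ball x₀ r) * ∫⁻ z in ball x₀ (lam * r), f z ∂μ := by
  have := hμ.sigmaFinite
  have := hμ.secondCountableTopology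
  obtain ⟨K, hK⟩ := hμ.exists_measure_ball_pow_le
  refine ⟨2 * K ^ 2 * (2 * (lam + 1)).toNNReal, fun x₀ r hr f hf => ?_⟩
  set B := ball x₀ r
  have hrk := measurable_rieszKernel μ
  have key : ∀ z ∈ ball x₀ (lam * r), ∫⁻ x in B, rieszKernel μ x z ∂μ ≤
      (K : ℝ≥0∞) ^ 2 * ((2 * (lam + 1)).toNNReal * ENNReal.ofReal r) := by
    intro z hz
    calc ∫⁻ x in B, rieszKernel μ x z ∂μ ≤ ∫⁻ x in ball z ((lam + 1) * r), rieszKernel μ x z ∂μ := by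
          refine lintegral_mono_set (ball_subset_ball' ?_)
          rw [mem_ball, dist_comm] at hz
          linarith
      _ ≤ (K : ℝ≥0∞) ^ 2 * ENNReal.ofReal (2 * ((lam + 1) * r)) :=
        lintegral_rieszKernel_left_le (fun x r => hμ.measure_ball_pos x)
          hμ.measure_ball_lt_top hK z _
      _ = _ := by
        rw [← mul_assoc, ENNReal.ofReal_mul' hr.le]; rfl
  have hin : ∀ z ∈ ball x₀ (lam * r),
      ∫⁻ p, semmesKernel μ p.1 p.2 z * f z ∂((μ.restrict B).prod (μ.restrict B)) ≤
      ((2 * K ^ 2 * (2 * (lam + 1)).toNNReal : ℝ≥0) * ENNReal.ofReal r * μ B) * f z := by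
    intro z hz
    have hz1 : Measurable fun x => rieszKernel μ x z := hrk.comp measurable_prodMk_right
    have h1 : Measurable fun p : X × X => rieszKernel μ p.1 z := hz1.comp measurable_fst
    have h2 : Measurable fun p : X × X => rieszKernel μ p.2 z := hz1.comp measurable_snd
    simp_rw [semmesKernel_eq]
    rw [lintegral_mul_const _ (by exact h1.add h2), lintegral_add_left h1,
      lintegral_prod _ h1.aemeasurable, lintegral_prod _ h2.aemeasurable]
    simp only [lintegral_const, Measure.restrict_apply_univ]
    rw [lintegral_mul_const _ hz1]
    gcongr
    calc _ = 2 * ((∫⁻ x in B, rieszKernel μ x z ∂μ) * μ B) := by rw [two_mul]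
      _ ≤ 2 * ((K : ℝ≥0∞) ^ 2 * ((2 * (lam + 1)).toNNReal * ENNReal.ofReal r) * μ B) := by
        gcongr; exact key z hz
      _ = _ := by push_cast; ring
  rw [lintegral_lintegral_swap (measurable_semmesKernel_mul hf).aemeasurable,
    ← lintegral_const_mul _ hf]
  exact setLIntegral_mono' measurableSet_ball hin

end Fubini

/-! ### Curves and pencils -/

section Pencil

variable {X : Type*} [MetricSpace X]

theorem RectCurve.dist_le (γ : RectCurve X) {s t : ℝ} (hs : s ∈ Icc 0 γ.length)
    (ht : t ∈ Icc 0 γ.length) (hst : s ≤ t) : dist (γ.toFun s) (γ.toFun t) ≤ t - s := by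
  have h := γ.unitSpeed hs ht
  have he := eVariationOn.edist_le γ.toFun (s := Icc 0 γ.length ∩ Icc s t)
    ⟨hs, left_mem_Icc.2 hst⟩ ⟨ht, right_mem_Icc.2 hst⟩
  rw [h, edist_dist, NNReal.coe_one, one_mul] at he
  exact (ENNReal.ofReal_le_ofReal_iff (by linarith)).1 he

theorem RectCurve.continuousOn (γ : RectCurve X) : ContinuousOn γ.toFun (Icc 0 γ.length) := by
  refine (LipschitzOnWith.of_dist_le_mul (K := 1) fun s hs t ht => ?_).continuousOn
  rw [NNReal.coe_one, one_mul, Real.dist_eq]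
  rcases le_total s t with h | h
  · rw [abs_sub_comm]
    exact (γ.dist_le hs ht h).trans (le_abs_self _)
  · rw [dist_comm]
    exact (γ.dist_le ht hs h).trans (le_abs_self _)

theorem RectCurve.subIntegral_le_lineIntegral (γ : RectCurve X) (ρ : X → ℝ≥0∞) {s t : ℝ}
    (hs : 0 ≤ s) (ht : t ≤ γ.length) : γ.subIntegral ρ s t ≤ γ.lineIntegral ρ :=
  lintegral_mono_set (Icc_subset_Icc hs ht)

variable [MeasurableSpace X]

theorem RectCurve.aemeasurable [BorelSpace X] (γ : RectCurve X) :
    AEMeasurable γ.toFun (volume.restrict (Icc 0 γ.length)) :=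
  γ.continuousOn.aemeasurable measurableSet_Icc

theorem RectCurve.lineIntegral_indicator [BorelSpace X] (γ : RectCurve X) {s : Set X}
    (hs : MeasurableSet s) (c : ℝ≥0∞) :
    γ.lineIntegral (s.indicator fun _ => c) = c * γ.lengthIn s := by
  have h : (s.indicator fun _ => c) = fun x => c * s.indicator 1 x := by
    ext x; by_cases hx : x ∈ s <;> simp [hx]
  have hm : Measurable (s.indicator (1 : X → ℝ≥0∞)) := measurable_one.indicator hs
  rw [h]
  exact lintegral_const_mul'' c (hm.comp_aemeasurable γ.aemeasurable)

theorem RectCurve.lineIntegral_add [BorelSpace X] (γ : RectCurve X) {f : X → ℝ≥0∞}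
    (hf : Measurable f) (g : X → ℝ≥0∞) :
    γ.lineIntegral (f + g) = γ.lineIntegral f + γ.lineIntegral g :=
  lintegral_add_left' (hf.comp_aemeasurable γ.aemeasurable) _

theorem RectCurve.lineIntegral_iSup [BorelSpace X] (γ : RectCurve X) {f : ℕ → X → ℝ≥0∞}
    (hf : ∀ n, Measurable (f n)) (hmono : Monotone f) :
    γ.lineIntegral (fun x => ⨆ n, f n x) = ⨆ n, γ.lineIntegral (f n) :=
  lintegral_iSup' (fun n => (hf n).comp_aemeasurable γ.aemeasurable)
    (ae_of_all _ fun _ _ _ h => hmono h _)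

/-- Otherwise almost all of `[a, b]` would be spent in `A ∩ W`. -/
theorem RectCurve.exists_notMem_of_lengthIn_lt [BorelSpace X] (γ : RectCurve X) {a b : ℝ}
    (ha : 0 ≤ a) (hb : b ≤ γ.length) {A W : Set X}
    (hW : ∀ s ∈ Icc a b, γ.toFun s ∈ W) (h : γ.lengthIn (A ∩ W) < ENNReal.ofReal (b - a))
    {N : Set ℝ} (hN : volume N = 0) : ∃ s ∈ Icc a b \ N, γ.toFun s ∉ A := by
  by_contra! hcon
  refine h.not_ge ?_
  calc ENNReal.ofReal (b - a) = ∫⁻ _ in Icc a b, 1 := by simp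
    _ = ∫⁻ τ in Icc a b, (A ∩ W).indicator (1 : X → ℝ≥0∞) (γ.toFun τ) := by
      refine setLIntegral_congr_fun_ae measurableSet_Icc ?_
      filter_upwards [measure_eq_zero_iff_ae_notMem.1 hN] with τ hτ hτab
      have hmem : γ.toFun τ ∈ A ∩ W := ⟨hcon τ ⟨hτab, hτ⟩, hW τ hτab⟩
      rw [indicator_of_mem hmem, Pi.one_apply]
    _ ≤ γ.lengthIn (A ∩ W) := γ.subIntegral_le_lineIntegral _ ha hb

/-- Passes from sets to functions through simple functions and monotone limits. On the kernel side
only superadditivity of the lower integral is used, so `k` need not be measurable. -/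
theorem aemeasurable_and_lintegral_lineIntegral_le [BorelSpace X] {μ : Measure X}
    {Γ : Set (RectCurve X)} [MeasurableSpace Γ] {σ : Measure Γ} {C : ℝ≥0∞} {S : Set X}
    {k : X → ℝ≥0∞}
    (h : ∀ A : Set X, MeasurableSet A → AEMeasurable (fun γ : Γ => γ.1.lengthIn A) σ ∧
      ∫⁻ γ : Γ, γ.1.lengthIn A ∂σ ≤ C * ∫⁻ z in A ∩ S, k z ∂μ)
    {f : X → ℝ≥0∞} (hf : Measurable f) :
    AEMeasurable (fun γ : Γ => γ.1.lineIntegral f) σ ∧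
      ∫⁻ γ : Γ, γ.1.lineIntegral f ∂σ ≤ C * ∫⁻ z in S, k z * f z ∂μ := by
  refine Measurable.ennreal_induction (motive := fun f =>
    AEMeasurable (fun γ : Γ => γ.1.lineIntegral f) σ ∧
      ∫⁻ γ : Γ, γ.1.lineIntegral f ∂σ ≤ C * ∫⁻ z in S, k z * f z ∂μ) ?_ ?_ ?_ hf
  · intro c s hs
    simp_rw [RectCurve.lineIntegral_indicator _ hs]
    refine ⟨(h s hs).1.const_mul c, ?_⟩
    rw [lintegral_const_mul'' _ (h s hs).1]
    calc c * ∫⁻ γ : Γ, γ.1.lengthIn s ∂σ ≤ c * (C * ∫⁻ z in s ∩ S, k z ∂μ) := by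
          gcongr; exact (h s hs).2
      _ = C * (c * ∫⁻ z in s ∩ S, k z ∂μ) := by ring
      _ ≤ C * ∫⁻ z in s ∩ S, c * k z ∂μ := by gcongr; exact lintegral_const_mul_le _ _
      _ = _ := by
        rw [← Measure.restrict_restrict hs, ← lintegral_indicator hs]
        congr 2
        ext z
        by_cases hz : z ∈ s <;> simp [hz, mul_comm]
  · intro f g _ hf hg ihf ihg
    simp_rw [RectCurve.lineIntegral_add _ hf]
    refine ⟨ihf.1.add ihg.1, ?_⟩
    rw [lintegral_add_left' ihf.1]
    refine (add_le_add ihf.2 ihg.2).trans ?_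
    rw [← mul_add]
    gcongr
    refine (le_lintegral_add _ _).trans (le_of_eq ?_)
    simp only [Pi.add_apply, mul_add]
  · intro f hf hmono ih
    simp_rw [RectCurve.lineIntegral_iSup _ hf hmono]
    refine ⟨AEMeasurable.iSup fun n => (ih n).1, ?_⟩
    rw [lintegral_iSup' (fun n => (ih n).1)
      (ae_of_all _ fun γ m n hmn => lintegral_mono fun τ => hmono hmn _)]
    refine iSup_le fun n => (ih n).2.trans ?_
    gcongr with z
    exact le_iSup (fun n => f n z) n

end Pencil

/-! ### Pointwise estimate for a pair of points -/

section Pair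

variable {X : Type*} [MetricSpace X] [MeasurableSpace X] [BorelSpace X] {μ : Measure X}
  {Γ : Set (RectCurve X)} [MeasurableSpace Γ] {σ : Measure Γ} {C : ℝ≥0} {x y : X}

theorem exists_radius_measure_lengthIn_ge_le (hμ : IsDoubling μ) (hxy : x ≠ y)
    (h : ∀ A : Set X, MeasurableSet A → AEMeasurable (fun γ : Γ => γ.1.lengthIn A) σ ∧
      ∫⁻ γ : Γ, γ.1.lengthIn A ∂σ ≤ C * ∫⁻ z in A, semmesKernel μ x y z ∂μ)
    {A : Set X} (hAm : MeasurableSet A)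
    (hA : Tendsto (fun s => μ (A ∩ closedBall x s) / μ (closedBall x s)) (𝓝[>] 0) (𝓝 0))
    (hlim : liminf (fun r : ℝ => μ (ball x r) / ENNReal.ofReal r) (𝓝[>] 0) = 0) :
    ∃ r, 0 < r ∧ r ≤ dist x y / 2 ∧
      σ {γ : Γ | ENNReal.ofReal (r / 2) ≤ γ.1.lengthIn (A ∩ ball x r)} ≤ 1 / 4 := by
  obtain ⟨ε, hε0, hε⟩ := ENNReal.exists_nnreal_pos_mul_lt (a := (C : ℝ≥0∞)) (b := 1 / 4 / 2)
    (by finiteness) (by simp)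
  obtain ⟨r, hr0, hr, hint⟩ := exists_radius_lintegral_semmesKernel_le hμ hxy hA hlim
    (ε := ε) (by exact_mod_cast hε0.ne') (half_pos (dist_pos.2 hxy))
  refine ⟨r, hr0, hr, ?_⟩
  obtain ⟨hm, hle⟩ := h (A ∩ ball x r) (hAm.inter measurableSet_ball)
  have hr2 : ENNReal.ofReal (r / 2) = ENNReal.ofReal r / 2 := by
    rw [ENNReal.ofReal_div_of_pos two_pos, ENNReal.ofReal_ofNat]
  refine (meas_ge_le_lintegral_div hm (ENNReal.ofReal_pos.2 (half_pos hr0)).ne'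
    ENNReal.ofReal_ne_top).trans ?_
  refine ENNReal.div_le_of_le_mul ?_
  calc ∫⁻ γ : Γ, γ.1.lengthIn (A ∩ ball x r) ∂σ
      ≤ C * (ε * ENNReal.ofReal r) := hle.trans (by gcongr)
    _ = ε * C * ENNReal.ofReal r := by ring
    _ ≤ 1 / 4 / 2 * ENNReal.ofReal r := by gcongr
    _ = 1 / 4 * ENNReal.ofReal (r / 2) := by rw [hr2]; simp only [div_eq_mul_inv]; ring

theorem enorm_sub_le_two_mul_lintegral_liminf [IsProbabilityMeasure σ] (hμ : IsDoubling μ)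
    (hxy : x ≠ y) (hend : ∀ γ ∈ Γ, γ.toFun 0 = x ∧ γ.toFun γ.length = y)
    (h : ∀ A : Set X, MeasurableSet A → AEMeasurable (fun γ : Γ => γ.1.lengthIn A) σ ∧
      ∫⁻ γ : Γ, γ.1.lengthIn A ∂σ ≤ C * ∫⁻ z in A, semmesKernel μ x y z ∂μ)
    {V : Type*} [NormedAddCommGroup V] {u : X → V} {ρ : ℕ → X → ℝ≥0∞}
    (hρ : ∀ i, Measurable (ρ i)) {Γ₀ : Set (RectCurve X)} (hΓ₀ : σ {γ : Γ | γ.1 ∈ Γ₀} = 0)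
    (hb : ∀ γ : RectCurve X, γ ∉ Γ₀ → ∃ N : Set ℝ, volume N = 0 ∧
      ∀ s ∈ Icc 0 γ.length \ N, ∀ t ∈ Icc 0 γ.length \ N, s < t →
        ‖u (γ.toFun s) - u (γ.toFun t)‖ₑ ≤ liminf (fun i => γ.subIntegral (ρ i) s t) atTop)
    (hx : ∀ δ : ℝ≥0, δ ≠ 0 →
      Tendsto (fun s => μ (toMeasurable μ {z | (δ : ℝ≥0∞) ≤ ‖u z - u x‖ₑ} ∩ closedBall x s) /
        μ (closedBall x s)) (𝓝[>] 0) (𝓝 0))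
    (hy : ∀ δ : ℝ≥0, δ ≠ 0 →
      Tendsto (fun s => μ (toMeasurable μ {z | (δ : ℝ≥0∞) ≤ ‖u z - u y‖ₑ} ∩ closedBall y s) /
        μ (closedBall y s)) (𝓝[>] 0) (𝓝 0))
    (hlx : liminf (fun r : ℝ => μ (ball x r) / ENNReal.ofReal r) (𝓝[>] 0) = 0)
    (hly : liminf (fun r : ℝ => μ (ball y r) / ENNReal.ofReal r) (𝓝[>] 0) = 0) :
    ‖u x - u y‖ₑ ≤ 2 * ∫⁻ γ : Γ, liminf (fun i => γ.1.lineIntegral (ρ i)) atTop ∂σ := by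
  refine ENNReal.le_of_forall_pos_le_add fun ε hε _ => ?_
  set δ : ℝ≥0 := ε / 2 with hδ
  have hδ0 : δ ≠ 0 := (half_pos hε).ne'
  have h2δ : (ε : ℝ≥0∞) = δ + δ := by rw [← ENNReal.coe_add, hδ, add_halves]
  set F : Γ → ℝ≥0∞ := fun γ => liminf (fun i => γ.1.lineIntegral (ρ i)) atTop with hF
  have hFm : AEMeasurable F σ := by
    have hm : ∀ i, AEMeasurable (fun γ : Γ => γ.1.lineIntegral (ρ i)) σ := fun i =>
      (aemeasurable_and_lintegral_lineIntegral_le (S := univ)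
        (fun A hA => by simpa using h A hA) (hρ i)).1
    simp_rw [hF, liminf_eq_iSup_iInf_of_nat']
    exact AEMeasurable.iSup fun n => AEMeasurable.iInf fun i => hm (i + n)
  set Ax := toMeasurable μ {z | (δ : ℝ≥0∞) ≤ ‖u z - u x‖ₑ} with hAx
  set Ay := toMeasurable μ {z | (δ : ℝ≥0∞) ≤ ‖u z - u y‖ₑ} with hAy
  have hAx' : ∀ z, z ∉ Ax → ‖u z - u x‖ₑ ≤ δ := fun z hz =>
    (not_le.1 fun hle => hz (subset_toMeasurable μ _ hle)).le
  have hAy' : ∀ z, z ∉ Ay → ‖u z - u y‖ₑ ≤ δ := fun z hz =>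
    (not_le.1 fun hle => hz (subset_toMeasurable μ _ hle)).le
  obtain ⟨r, hr0, hrd, hr⟩ := exists_radius_measure_lengthIn_ge_le hμ hxy h
    (measurableSet_toMeasurable _ _) (hx δ hδ0) hlx
  obtain ⟨r', hr0', hrd', hr'⟩ := exists_radius_measure_lengthIn_ge_le hμ hxy.symm
    (fun A hA => by simp_rw [semmesKernel_comm μ y x]; exact h A hA)
    (measurableSet_toMeasurable _ _) (hy δ hδ0) hly
  rw [dist_comm] at hrd'
  set c := ‖u x - u y‖ₑ - ε with hc
  -- A curve outside the last three sets has admissible parameters `s`, `t` near its ends where `u`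
  -- is `δ`-close to `u x` and `u y`, which forces `c ≤ F γ`.
  have hcover : (univ : Set Γ) ⊆ {γ | c ≤ F γ} ∪ {γ : Γ | γ.1 ∈ Γ₀} ∪
      ({γ : Γ | ENNReal.ofReal (r / 2) ≤ γ.1.lengthIn (Ax ∩ ball x r)} ∪
        {γ : Γ | ENNReal.ofReal (r' / 2) ≤ γ.1.lengthIn (Ay ∩ ball y r')}) := by
    intro γ _
    by_contra hcon
    simp only [mem_union, mem_ofPred_eq, not_or, not_le] at hcon
    obtain ⟨⟨hcF, hγ⟩, hγx, hγy⟩ := hcon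
    refine hcF.not_ge ?_
    obtain ⟨N, hN, hNb⟩ := hb γ.1 hγ
    obtain ⟨he0, heL⟩ := hend γ.1 γ.2
    set L := γ.1.length with hL
    have hLpos : 0 < L := γ.1.length_pos
    have hdL : dist x y ≤ L := by
      have := γ.1.dist_le (left_mem_Icc.2 hLpos.le) (right_mem_Icc.2 hLpos.le) hLpos.le
      rwa [← hL, he0, heL, sub_zero] at this
    -- Arc length is 1-Lipschitz, so the first `r/2` of the curve stays in `B(x,r)`. As `r` and `r'`
    -- are at most `d(x,y)/2`, the initial and final pieces are disjoint and `s < t`.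
    obtain ⟨s, ⟨hs, hsN⟩, hsA⟩ := γ.1.exists_notMem_of_lengthIn_lt (a := 0) (b := r / 2) le_rfl
      (by linarith) (A := Ax) (W := ball x r) (fun s hs => by
        have := γ.1.dist_le (left_mem_Icc.2 hLpos.le) (t := s) ⟨hs.1, by linarith [hs.2]⟩ hs.1
        rw [he0, dist_comm] at this
        exact mem_ball.2 (by linarith [hs.2])) (by rwa [sub_zero]) hN
    obtain ⟨t, ⟨ht, htN⟩, htA⟩ := γ.1.exists_notMem_of_lengthIn_lt (a := L - r' / 2) (b := L)
      (by linarith) le_rfl (A := Ay) (W := ball y r') (fun t ht => by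
        have := γ.1.dist_le (s := t) ⟨by linarith [ht.1], ht.2⟩ (right_mem_Icc.2 hLpos.le) ht.2
        rw [← hL, heL] at this
        exact mem_ball.2 (by linarith [ht.1])) (by rwa [sub_sub_cancel]) hN
    have hs' : s ∈ Icc 0 L := ⟨hs.1, by linarith [hs.2]⟩
    have ht' : t ∈ Icc 0 L := ⟨by linarith [ht.1], ht.2⟩
    have hst := hNb s ⟨hs', hsN⟩ t ⟨ht', htN⟩ (by linarith [hs.2, ht.1])
    have hFst : ‖u (γ.1.toFun s) - u (γ.1.toFun t)‖ₑ ≤ F γ := hst.trans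
      (liminf_le_liminf (Eventually.of_forall fun i =>
        γ.1.subIntegral_le_lineIntegral (ρ i) hs'.1 ht'.2))
    rw [hc, tsub_le_iff_right, h2δ]
    calc ‖u x - u y‖ₑ = ‖(u (γ.1.toFun s) - u (γ.1.toFun t)) + ((u x - u (γ.1.toFun s))
          + (u (γ.1.toFun t) - u y))‖ₑ := by congr 1; abel
      _ ≤ ‖u (γ.1.toFun s) - u (γ.1.toFun t)‖ₑ + (‖u x - u (γ.1.toFun s)‖ₑ
          + ‖u (γ.1.toFun t) - u y‖ₑ) :=
        (enorm_add_le _ _).trans (by gcongr; exact enorm_add_le _ _)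
      _ ≤ F γ + (δ + δ) := by
        gcongr
        · rw [← enorm_neg, neg_sub]
          exact hAx' _ hsA
        · exact hAy' _ htA
  -- The bad curves have mass at most `1/4` for each endpoint; the remaining half produces the
  -- factor 2.
  have hhalf : 1 / 2 ≤ σ {γ | c ≤ F γ} := by
    have h1 : (1 : ℝ≥0∞) ≤ σ {γ | c ≤ F γ} + 1 / 2 := by
      calc (1 : ℝ≥0∞) = σ univ := measure_univ.symm
        _ ≤ _ := measure_mono hcover
        _ ≤ σ {γ | c ≤ F γ} + 0 + (1 / 4 + 1 / 4) :=
          (measure_union_le _ _).trans (add_le_add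
            ((measure_union_le _ _).trans (by rw [hΓ₀])) ((measure_union_le _ _).trans
              (add_le_add hr hr')))
        _ = σ {γ | c ≤ F γ} + 1 / 2 := by
          rw [add_zero, ENNReal.div_add_div_same, one_add_one_eq_two]
          congr 1
          rw [ENNReal.div_eq_div_iff] <;> norm_num
    have := tsub_le_iff_right.2 h1
    simpa using this
  have hmk := mul_meas_ge_le_lintegral₀ hFm c
  rw [← tsub_le_iff_right]
  calc c = 2 * (c * (1 / 2)) := by
        rw [one_div, mul_comm c, ← mul_assoc, ENNReal.mul_inv_cancel two_ne_zero (by simp), one_mul]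
    _ ≤ 2 * ∫⁻ γ, F γ ∂σ := by
      gcongr
      exact (mul_le_mul_right hhalf c).trans hmk

end Pair

theorem AM.exists_of_lt {X : Type*} [MetricSpace X] [MeasurableSpace X] {μ : Measure X}
    {Γ : Set (RectCurve X)} {ε : ℝ≥0∞} (h : AM μ Γ < ε) :
    ∃ ρ : ℕ → X → ℝ≥0∞, (∀ i, Measurable (ρ i)) ∧
      (∀ γ ∈ Γ, 1 ≤ liminf (fun i => γ.lineIntegral (ρ i)) atTop) ∧
      liminf (fun i => ∫⁻ x, ρ i x ∂μ) atTop < ε := by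
  simpa only [AM, iInf_lt_iff, exists_prop] using h

/-- Writes `u y - u_B` as the average of `u y - u z` over `z` and moves the norm inside. -/
theorem laverage_enorm_sub_average_le {X : Type*} [MeasurableSpace X] {μ : Measure X} [SFinite μ]
    {V : Type*} [NormedAddCommGroup V] [NormedSpace ℝ V] [CompleteSpace V] {u : X → V} (hu : Integrable u μ) {B : Set X}
    (h0 : μ B ≠ 0) (ht : μ B ≠ ∞) :
    ⨍⁻ y in B, ‖u y - ⨍ z in B, u z ∂μ‖ₑ ∂μ ≤
      (μ B)⁻¹ * (μ B)⁻¹ *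
        ∫⁻ p, ‖u p.1 - u p.2‖ₑ ∂((μ.restrict B).prod (μ.restrict B)) := by
  have hum := hu.aestronglyMeasurable.restrict (s := B)
  have : IsProbabilityMeasure ((μ B)⁻¹ • μ.restrict B) :=
    ⟨by simp [ENNReal.inv_mul_cancel h0 ht]⟩
  have hint : Integrable u ((μ B)⁻¹ • μ.restrict B) :=
    hu.restrict.smul_measure (ENNReal.inv_ne_top.2 h0)
  have hpt : ∀ y, ‖u y - ⨍ z in B, u z ∂μ‖ₑ ≤ (μ B)⁻¹ * ∫⁻ z in B, ‖u y - u z‖ₑ ∂μ := by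
    intro y
    have : u y - ⨍ z in B, u z ∂μ = ∫ z, (u y - u z) ∂((μ B)⁻¹ • μ.restrict B) := by
      rw [integral_sub (integrable_const _) hint, integral_const, setAverage_eq']
      simp
    rw [this]
    refine (enorm_integral_le_lintegral_enorm _).trans ?_
    rw [lintegral_smul_measure, smul_eq_mul]
  have hsub : AEStronglyMeasurable (fun p : X × X => u p.1 - u p.2)
      ((μ.restrict B).prod (μ.restrict B)) := hum.comp_fst.sub hum.comp_snd
  rw [setLAverage_eq, div_eq_mul_inv, mul_comm, mul_assoc,
    lintegral_prod _ hsub.enorm]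
  gcongr
  refine (lintegral_mono hpt).trans ?_
  rw [lintegral_const_mul' _ _ (ENNReal.inv_ne_top.2 h0)]

/-! ### The exceptional family and the Poincaré inequality -/

section Poincare

variable {X : Type*} [MetricSpace X] [MeasurableSpace X] [BorelSpace X] {μ : Measure X}

theorem lintegral_liminf_lineIntegral_le {Γ : Set (RectCurve X)} [MeasurableSpace Γ]
    {σ : Measure Γ} {C : ℝ≥0∞} {S T : Set X} {k : X → ℝ≥0∞} (hST : S ⊆ T)
    (h : ∀ A : Set X, MeasurableSet A → AEMeasurable (fun γ : Γ => γ.1.lengthIn A) σ ∧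
      ∫⁻ γ : Γ, γ.1.lengthIn A ∂σ ≤ C * ∫⁻ z in A ∩ S, k z ∂μ)
    {ρ : ℕ → X → ℝ≥0∞} (hρ : ∀ i, Measurable (ρ i)) :
    ∫⁻ γ : Γ, liminf (fun i => γ.1.lineIntegral (ρ i)) atTop ∂σ ≤
      liminf (fun i => C * ∫⁻ z in T, k z * ρ i z ∂μ) atTop := by
  have hm := fun i => aemeasurable_and_lintegral_lineIntegral_le h (hρ i)
  refine (lintegral_liminf_le' fun i => (hm i).1).trans (liminf_le_liminf
    (Eventually.of_forall fun i => (hm i).2.trans ?_))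
  gcongr

theorem lintegral_prod_liminf_semmesKernel_le (hμ : IsDoubling μ) (lam : ℝ) :
    ∃ M : ℝ≥0, ∀ (x₀ : X) (r : ℝ), 0 < r → ∀ (C : ℝ≥0) (ρ : ℕ → X → ℝ≥0∞),
      (∀ i, Measurable (ρ i)) →
      ∫⁻ p, liminf (fun i => C * ∫⁻ z in ball x₀ (lam * r),
          semmesKernel μ p.1 p.2 z * ρ i z ∂μ) atTop
          ∂((μ.restrict (ball x₀ r)).prod (μ.restrict (ball x₀ r))) ≤
        C * (M * ENNReal.ofReal r * μ (ball x₀ r)) *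
          liminf (fun i => ∫⁻ z in ball x₀ (lam * r), ρ i z ∂μ) atTop := by
  have := hμ.sigmaFinite
  have := hμ.secondCountableTopology
  obtain ⟨M, hM⟩ := lintegral_prod_lintegral_semmesKernel_le hμ lam
  refine ⟨M, fun x₀ r hr C ρ hρ => ?_⟩
  have hm : ∀ i, Measurable fun p : X × X => ∫⁻ z in ball x₀ (lam * r),
      semmesKernel μ p.1 p.2 z * ρ i z ∂μ := fun i =>
    (measurable_semmesKernel_mul (hρ i)).lintegral_prod_right'
  have hfin : (C : ℝ≥0∞) * (M * ENNReal.ofReal r * μ (ball x₀ r)) ≠ ∞ := by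
    have := hμ.measure_ball_lt_top x₀ r
    finiteness
  rw [← ENNReal.liminf_const_mul_of_ne_top hfin]
  refine (lintegral_liminf_le fun i => (hm i).const_mul _).trans (liminf_le_liminf
    (Eventually.of_forall fun i => ?_))
  rw [lintegral_const_mul _ (hm i), mul_assoc (C : ℝ≥0∞)]
  gcongr
  exact hM x₀ r hr (ρ i) (hρ i)

theorem HasSemmesPencil.exists_lintegral_prod_enorm_sub_le (hμ : IsDoubling μ)
    (hX : HasSemmesPencil μ)
    (hlim : ∀ᵐ x ∂μ, liminf (fun r : ℝ => μ (ball x r) / ENNReal.ofReal r) (𝓝[>] 0) = 0) :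
    ∃ (M : ℝ≥0) (lam : ℝ), 1 ≤ lam ∧ ∀ {V : Type v} [NormedAddCommGroup V] {u : X → V},
      Integrable u μ → ∀ {ρ : ℕ → X → ℝ≥0∞}, IsAMBounding μ u ρ →
      ∀ (x₀ : X) (r : ℝ), 0 < r →
        ∫⁻ p, ‖u p.1 - u p.2‖ₑ ∂((μ.restrict (ball x₀ r)).prod (μ.restrict (ball x₀ r))) ≤
          M * ENNReal.ofReal r * μ (ball x₀ r) *
            liminf (fun i => ∫⁻ z in ball x₀ (lam * r), ρ i z ∂μ) atTop := by
  have := hμ.sigmaFinite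
  have := hμ.secondCountableTopology
  obtain ⟨C, hC, hpen⟩ := hX
  -- For `x`, `y` in `B(x₀,r)` one has `C d(x,y) ≤ 2Cr`, so the pencil's balls lie in `B(x₀, (2C+1)
  -- r)`.
  set lam : ℝ := 2 * C + 1 with hlam
  obtain ⟨M, hM⟩ := lintegral_prod_liminf_semmesKernel_le hμ lam
  refine ⟨2 * (C.toNNReal * M), lam, by linarith, fun {V} _ {u} hu {ρ} hρ x₀ r hr => ?_⟩
  obtain ⟨hρm, Γ₀, hAM, hb⟩ := hρ
  set B := ball x₀ r with hB
  set C' : ℝ≥0 := C.toNNReal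
  have hBt : μ B < ∞ := hμ.measure_ball_lt_top x₀ r
  set H : (ℕ → X → ℝ≥0∞) → X × X → ℝ≥0∞ := fun f p =>
    liminf (fun i => C' * ∫⁻ z in ball x₀ (lam * r), semmesKernel μ p.1 p.2 z * f i z ∂μ) atTop
    with hH
  have hHm : ∀ f : ℕ → X → ℝ≥0∞, (∀ i, Measurable (f i)) → Measurable (H f) := fun f hf =>
    Measurable.liminf fun i =>
      (measurable_semmesKernel_mul (hf i)).lintegral_prod_right'.const_mul _
  have hε : ∀ n : ℕ, AM μ Γ₀ < ((n : ℝ≥0∞) + 1)⁻¹ := fun n => by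
    rw [hAM]
    exact ENNReal.inv_pos.2 (by finiteness)
  choose f hfm hf1 hf using fun n => AM.exists_of_lt (hε n)
  -- The integral of `H (f n)` is at most a fixed finite constant times the energy bound `1/(n+1)`.
  have hzero : ∀ᵐ p ∂((μ.restrict B).prod (μ.restrict B)), ⨅ n, H (f n) p = 0 := by
    refine (lintegral_eq_zero_iff (Measurable.iInf fun n => hHm _ (hfm n))).1 ?_
    set c : ℝ≥0∞ := C' * (M * ENNReal.ofReal r * μ B) with hc
    have hct : c ≠ ∞ := by finiteness
    have hle : ∀ n : ℕ, ∫⁻ p, ⨅ n, H (f n) p ∂((μ.restrict B).prod (μ.restrict B)) ≤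
        c * ((n : ℝ≥0∞) + 1)⁻¹ := fun n => by
      refine (lintegral_mono fun p => iInf_le _ n).trans
        ((hM x₀ r hr C' (f n) (hfm n)).trans ?_)
      gcongr
      refine le_trans (liminf_le_liminf (Eventually.of_forall fun i => ?_)) (hf n).le
      exact setLIntegral_le_lintegral _ _
    have htend : Tendsto (fun n : ℕ => c * ((n : ℝ≥0∞) + 1)⁻¹) atTop (𝓝 0) := by
      have h1 : Tendsto (fun n : ℕ => (((n + 1 : ℕ) : ℝ≥0∞))⁻¹) atTop (𝓝 0) :=
        ENNReal.tendsto_inv_nat_nhds_zero.comp (tendsto_add_atTop_nat 1)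
      have := ENNReal.Tendsto.const_mul h1 (Or.inr hct)
      simpa using this
    exact le_antisymm (ge_of_tendsto' htend hle) zero_le
  have hae : ∀ᵐ x ∂(μ.restrict B), x ∈ B ∧
      liminf (fun r : ℝ => μ (ball x r) / ENNReal.ofReal r) (𝓝[>] 0) = 0 ∧
      ∀ δ : ℝ≥0, δ ≠ 0 →
      Tendsto (fun s => μ (toMeasurable μ {z | (δ : ℝ≥0∞) ≤ ‖u z - u x‖ₑ} ∩ closedBall x s) /
        μ (closedBall x s)) (𝓝[>] 0) (𝓝 0) := by
    filter_upwards [ae_restrict_mem measurableSet_ball, ae_restrict_of_ae hlim,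
      ae_restrict_of_ae (ae_tendsto_measure_enorm_sub_ge_div hμ hu)] with x h1 h2 h3
    exact ⟨h1, h2, h3⟩
  have hmain : ∀ᵐ p ∂((μ.restrict B).prod (μ.restrict B)),
      ‖u p.1 - u p.2‖ₑ ≤ 2 * H ρ p := by
    filter_upwards [hzero, Measure.quasiMeasurePreserving_fst.ae hae,
      Measure.quasiMeasurePreserving_snd.ae hae] with ⟨x, y⟩ h0 hx hy
    obtain ⟨hxB, hxl, hxu⟩ := hx
    obtain ⟨hyB, hyl, hyu⟩ := hy
    simp only at h0 hxB hxl hxu hyB hyl hyu ⊢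
    rcases eq_or_ne x y with rfl | hxy
    · simp
    obtain ⟨Γ, _, σ, hσ, hend, hpenc⟩ := hpen x y hxy
    have hd : dist x y < 2 * r := by
      have h1 : dist x x₀ < r := hxB
      have h2 : dist y x₀ < r := hyB
      have := dist_triangle_right x y x₀
      linarith
    have hCd : C * dist x y ≤ C * (2 * r) := by gcongr
    have hsub : ball x (C * dist x y) ∪ ball y (C * dist x y) ⊆ ball x₀ (lam * r) := by
      refine union_subset (ball_subset_ball' ?_) (ball_subset_ball' ?_)
      · have h1 : dist x x₀ < r := hxB
        rw [hlam]; linarith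
      · have h2 : dist y x₀ < r := hyB
        rw [hlam]; linarith
    have hline : ∀ g : ℕ → X → ℝ≥0∞, (∀ i, Measurable (g i)) →
        ∫⁻ γ : Γ, liminf (fun i => γ.1.lineIntegral (g i)) atTop ∂σ ≤ H g (x, y) :=
      fun g hg => lintegral_liminf_lineIntegral_le hsub hpenc hg
    -- `Γ₀` need not be measurable, but it lies in each set where the liminf for `f n` is at least
    -- 1; Markov bounds the measure of that set by `H (f n) (x, y)`.
    have hnull : σ {γ : Γ | γ.1 ∈ Γ₀} = 0 := by
      refine le_antisymm ?_ zero_le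
      rw [← h0]
      refine le_iInf fun n => le_trans ?_ (hline (f n) (hfm n))
      have hm : AEMeasurable
          (fun γ : Γ => liminf (fun i => γ.1.lineIntegral (f n i)) atTop) σ := by
        simp_rw [liminf_eq_iSup_iInf_of_nat']
        exact AEMeasurable.iSup fun _ => AEMeasurable.iInf fun _ =>
          (aemeasurable_and_lintegral_lineIntegral_le hpenc (hfm n _)).1
      have hmk := mul_meas_ge_le_lintegral₀ hm 1
      rw [one_mul] at hmk
      exact (measure_mono fun γ hγ => hf1 n γ.1 hγ).trans hmk
    refine (enorm_sub_le_two_mul_lintegral_liminf (C := C') hμ hxy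
      (fun γ hγ => ⟨(hend γ hγ).1, (hend γ hγ).2.1⟩)
      (fun A hA => ⟨(hpenc A hA).1, (hpenc A hA).2.trans ?_⟩) hρm hnull hb hxu hyu hxl hyl).trans ?_
    · exact mul_le_mul_right (lintegral_mono_set inter_subset_left) _
    · exact mul_le_mul_right (hline ρ hρm) _
  calc _ ≤ ∫⁻ p, 2 * H ρ p ∂((μ.restrict B).prod (μ.restrict B)) := lintegral_mono_ae hmain
    _ = 2 * ∫⁻ p, H ρ p ∂((μ.restrict B).prod (μ.restrict B)) :=
      lintegral_const_mul _ (hHm ρ hρm)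
    _ ≤ 2 * (C' * (M * ENNReal.ofReal r * μ B) *
          liminf (fun i => ∫⁻ z in ball x₀ (lam * r), ρ i z ∂μ) atTop) :=
      mul_le_mul_right (hM x₀ r hr C' ρ hρm) _
    _ = _ := by push_cast; ring

end Poincare

end AMBV

theorem mainTheorem3 {X : Type u} [MetricSpace X] [CompleteSpace X]
    [MeasurableSpace X] [BorelSpace X] (μ : Measure X)
    (hμ : AMBV.IsDoubling μ) (hX : AMBV.HasSemmesPencil μ)
    (hlim : ∀ᵐ x ∂μ,
      liminf (fun r : ℝ => μ (Metric.ball x r) / ENNReal.ofReal r) (𝓝[>] 0) = 0) :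
    ∃ C lam : ℝ, 0 < C ∧ 1 ≤ lam ∧
      ∀ (V : Type v) [NormedAddCommGroup V] [NormedSpace ℝ V] [CompleteSpace V],
        AMBV.AMPoincareWith μ V C lam := by
  have := hμ.sigmaFinite
  obtain ⟨M, lam, hlam, hM⟩ :=
    AMBV.HasSemmesPencil.exists_lintegral_prod_enorm_sub_le.{v} hμ hX hlim
  obtain ⟨K, hK⟩ := hμ.exists_measure_ball_pow_le
  obtain ⟨n, hn⟩ := pow_unbounded_of_one_lt lam (one_lt_two (α := ℝ))
  -- `K ^ n` is the price of normalizing by `μ(λB)` instead of `μ(B)`; the `+ 1` only makes the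
  -- constant positive.
  refine ⟨M * K ^ n + 1, lam, by positivity, hlam, fun V _ _ _ u hu ρ hρ x r hr => ?_⟩
  have h0 := (hμ.measure_ball_pos x hr).ne'
  have ht := (hμ.measure_ball_lt_top x r).ne
  have hl0 := (hμ.measure_ball_pos x (mul_pos (zero_lt_one.trans_le hlam) hr)).ne'
  have hlt := (hμ.measure_ball_lt_top x (lam * r)).ne
  set b := μ (Metric.ball x r) with hb
  set b' := μ (Metric.ball x (lam * r)) with hb'
  have hbb : b' ≤ (K : ℝ≥0∞) ^ n * b :=
    (measure_mono (Metric.ball_subset_ball (by gcongr))).trans (hK n x r hr)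
  have hbinv : b⁻¹ ≤ (K : ℝ≥0∞) ^ n * b'⁻¹ := by
    rw [← div_eq_mul_inv, ENNReal.le_div_iff_mul_le (Or.inl hl0) (Or.inl hlt)]
    calc b⁻¹ * b' ≤ b⁻¹ * ((K : ℝ≥0∞) ^ n * b) := by gcongr
      _ = (K : ℝ≥0∞) ^ n * (b⁻¹ * b) := by ring
      _ = (K : ℝ≥0∞) ^ n := by rw [ENNReal.inv_mul_cancel h0 ht, mul_one]
  have hliminf : liminf (fun i => ⨍⁻ y in Metric.ball x (lam * r), ρ i y ∂μ) atTop =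
      b'⁻¹ * liminf (fun i => ∫⁻ y in Metric.ball x (lam * r), ρ i y ∂μ) atTop := by
    rw [← ENNReal.liminf_const_mul_of_ne_top (ENNReal.inv_ne_top.2 hl0)]
    simp_rw [setLAverage_eq, div_eq_mul_inv, mul_comm]
    rfl
  rw [hliminf]
  set I := liminf (fun i => ∫⁻ y in Metric.ball x (lam * r), ρ i y ∂μ) atTop with hI
  calc _ ≤ b⁻¹ * b⁻¹ * (M * ENNReal.ofReal r * b * I) :=
        (AMBV.laverage_enorm_sub_average_le hu.1 h0 ht).trans
          (mul_le_mul_right (hM hu.1 hρ x r hr) _)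
    _ = M * ENNReal.ofReal r * (b⁻¹ * b) * b⁻¹ * I := by ring
    _ = M * ENNReal.ofReal r * b⁻¹ * I := by rw [ENNReal.inv_mul_cancel h0 ht, mul_one]
    _ ≤ M * ENNReal.ofReal r * ((K : ℝ≥0∞) ^ n * b'⁻¹) * I := by gcongr
    _ = ((M * K ^ n : NNReal) : ℝ≥0∞) * ENNReal.ofReal r * (b'⁻¹ * I) := by push_cast; ring
    _ ≤ ENNReal.ofReal ((M * K ^ n + 1) * r) * (b'⁻¹ * I) := by
      rw [ENNReal.ofReal_mul (by positivity)]
      gcongr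
      rw [← ENNReal.ofReal_coe_nnreal]
      exact ENNReal.ofReal_le_ofReal (by push_cast; linarith)
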